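/- For a monoid $M$ write $H_n(M)=\operatorname{Tor}_n^{\mathbb{Z}M}(\mathbb{Z},\mathbb{Z})$, where $\mathbb{Z}$ carries the trivial action; for a semigroup $S$ put $H_n(S)=H_n(S^1)$, where $S^1$ is the monoid obtained from $S$ by adjoining an identity. For a finitely generated abelian group $A$ let $d(A)$ be the minimal number of generators of $A$ and $\operatorname{rk}A=\dim_{\mathbb{Q}}(\mathbb{Q}\otimes_{\mathbb{Z}}A)$. For a group $G$, let $G^{ab}=G/[G,G]$. **Theorem (Pride).** Let $\langle X\mid R\rangle$ be a finite presentation of a monoid $M$, and let $G(M)$ be the group defined by the same presentation $\langle X\mid R\rangle$ (each relation $u=v$ giving the relator $uv^{-1}$). Then $H_2(M)$ is finitely generated and $$|R|-|X|\ \ge\ d(H_2(M))-\operatorname{rk}\bigl(G(M)^{ab}\bigr).$$ If moreover $M$ is finite, or $M$ has no nontrivial homomorphism to $\mathbb{Z}$, then $$|R|-|X|\ \ge\ d(H_2(M)).$$ The same results hold for a finite semigroup presentation $\langle X\mid R\rangle$ of a semigroup $S$, with $H_2(S)$ and the group $G(S)$ defined by $\langle X\mid R\rangle$ in place of $H_2(M)$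 and $G(M)$, and with "homomorphism to $\mathbb{Z}$" meaning semigroup homomorphism to $(\mathbb{Z},+)$. -/

import Mathlib

open CategoryTheory
open scoped TensorProduct

universe u v

instance repIntEnoughProjectives (M : Type v) [Monoid M] :
    EnoughProjectives (Rep.{v} ℤ M) :=
  Rep.equivalenceModuleMonoidAlgebra.enoughProjectives_iff.2 ModuleCat.enoughProjectives.{v}

/-- The `n`-th Eilenberg--Mac Lane homology group `H_n(M) = Tor_n^{ℤM}(ℤ, ℤ)` of a monoid `M`:
the `n`-th left derived functor of `A ↦ A_M = A / ⟨m a - a⟩ ≅ ℤ ⊗_{ℤM} A` on the category of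
left `ℤM`-modules (`ℤ`-linear representations of `M`), evaluated at the trivial module `ℤ`. -/
noncomputable def monoidHomology (n : ℕ) (M : Type v) [Monoid M] : ModuleCat.{v} ℤ :=
  ((Rep.coinvariantsFunctor.{v} ℤ M).leftDerived n).obj (Rep.trivial ℤ M (ULift.{v} ℤ))

/-- The homology of a semigroup `S` is that of the monoid `S¹`, where `S¹` is `S` with an
identity adjoined (`WithOne S`). -/
noncomputable def semigroupHomology (n : ℕ) (S : Type v) [Semigroup S] : ModuleCat.{v} ℤ :=
  monoidHomology n (WithOne S)

/-- The monoid `M` is presented by `⟨X | R⟩`: it is isomorphic to the quotient of the free monoid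
on `X` by the congruence generated by the pairs `(u, v) ∈ R`. -/
def IsMonoidPresentation {X : Type u} (R : Finset (FreeMonoid X × FreeMonoid X))
    (M : Type v) [Monoid M] : Prop :=
  Nonempty (PresentedMonoid (fun a b : FreeMonoid X => (a, b) ∈ R) ≃* M)

/-- The semigroup `S` is presented by `⟨X | R⟩`: it is isomorphic to the quotient of the free
semigroup on `X` by the congruence generated by the pairs `(u, v) ∈ R`. -/
def IsSemigroupPresentation {X : Type u} (R : Finset (FreeSemigroup X × FreeSemigroup X))
    (S : Type v) [Semigroup S] : Prop :=
  Nonempty ((conGen (fun a b : FreeSemigroup X => (a, b) ∈ R)).Quotient ≃* S)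

/-- The group with the same presentation as the monoid `⟨X | R⟩`, the relation `u = v`
corresponding to the relator `u v⁻¹`. -/
abbrev MonoidPresentationGroup {X : Type u} (R : Finset (FreeMonoid X × FreeMonoid X)) : Type u :=
  PresentedGroup {g : FreeGroup X | ∃ p ∈ R,
    g = FreeMonoid.lift FreeGroup.of p.1 * (FreeMonoid.lift FreeGroup.of p.2)⁻¹}

/-- The group with the same presentation as the semigroup `⟨X | R⟩`, the relation `u = v`
corresponding to the relator `u v⁻¹`. -/
abbrev SemigroupPresentationGroup {X : Type u}
    (R : Finset (FreeSemigroup X × FreeSemigroup X)) : Type u :=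
  PresentedGroup {g : FreeGroup X | ∃ p ∈ R,
    g = FreeSemigroup.lift FreeGroup.of p.1 * (FreeSemigroup.lift FreeGroup.of p.2)⁻¹}

/-- The rank `dim_ℚ (ℚ ⊗_ℤ G^ab)` of the abelianization of a group. -/
noncomputable def abelianizationRank (G : Type u) [Group G] : ℕ :=
  Module.finrank ℚ (ℚ ⊗[ℤ] Additive (Abelianization G))

-- A presentation of M gives the start of a free resolution of ℤ over ℤM, ℤM[R] → ℤM[X] → ℤM → ℤ,
-- whose first map is built from Fox derivatives (`exact_d₁_d₀`, `exact_d₀_augmentation`). On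
-- coinvariants that map becomes D : ℤ^R → ℤ^X, and H₂(M) is a quotient of ker D
-- (`exists_surjective_ker_leftDerived_two`). Since ker D is free of rank |R| - |X| + rk(coker D),
-- that many elements generate H₂(M).
--
-- The cokernel Q of D is generated by X and satisfies the relations R. Hence it is a quotient of
-- G(M)^ab, which bounds rk Q. Moreover M maps to Q with image containing a generating set, so rk Q
-- > 0 would give a nontrivial homomorphism M → ℤ; finite monoids have none. For a semigroup S, the
-- same X and R present S¹ as a monoid.

universe w

/-! ### Partial projective resolutions and the second derived functor -/

section PartialResolution

open Limits

variable {C : Type*} [Category* C] [Abelian C] [EnoughProjectives C]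
variable {Z P₀ P₁ P₂ : C} (ε : P₀ ⟶ Z) (d₀ : P₁ ⟶ P₀) (d₁ : P₂ ⟶ P₁)

/-- A projective cover of the syzygies, continuing a short complex to the left. -/
noncomputable def projectiveStep (S : ShortComplex C) :
    Σ' (X : C) (d : X ⟶ S.X₁), d ≫ S.f = 0 :=
  ⟨Projective.syzygies S.f, Projective.d S.f, (Category.assoc _ _ _).trans
    ((congrArg (Projective.π (kernel S.f) ≫ ·) (kernel.condition S.f)).trans comp_zero)⟩

/-- The chain complex continuing `P₂ ⟶ P₁ ⟶ P₀` by projective covers of the syzygies. -/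
noncomputable def extendComplex (w : d₁ ≫ d₀ = 0) : ChainComplex C ℕ :=
  ChainComplex.mk P₀ P₁ P₂ d₀ d₁ w projectiveStep

/-- In degree 1 this is the hypothesis; above it, each new term covers the kernel of the preceding
differential. -/
lemma extendComplex_exactAt_succ (w : d₁ ≫ d₀ = 0) (h : (ShortComplex.mk d₁ d₀ w).Exact) (n : ℕ) :
    (extendComplex d₀ d₁ w).ExactAt (n + 1) := by
  rw [HomologicalComplex.exactAt_iff' _ (n + 1 + 1) (n + 1) n (by simp) (by simp)]
  match n with
  | 0 =>
    refine ShortComplex.exact_of_iso (ShortComplex.isoMk (S₁ := ShortComplex.mk d₁ d₀ w)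
      (Iso.refl _) (Iso.refl _) (Iso.refl _) ?_ ?_) h
    · exact (Category.id_comp _).trans ((ChainComplex.mk_d_2_1 ..).trans (Category.comp_id _).symm)
    · exact (Category.id_comp _).trans ((ChainComplex.mk_d_1_0 ..).trans (Category.comp_id _).symm)
  | n + 1 =>
    refine ShortComplex.exact_of_iso (ShortComplex.isoMk
      (S₁ := ShortComplex.mk (Projective.d ((extendComplex d₀ d₁ w).d (n + 2) (n + 1))) _ _)
      (ChainComplex.mkXIso P₀ P₁ P₂ d₀ d₁ w projectiveStep n).symm (Iso.refl _) (Iso.refl _) ?_ ?_)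
      (exact_d_f ((extendComplex d₀ d₁ w).d (n + 2) (n + 1)))
    · exact ((Iso.inv_comp_eq _).2 (ChainComplex.mk_d ..)).trans (Category.comp_id _).symm
    · exact (Category.id_comp _).trans (Category.comp_id _).symm

lemma extendComplex_projective [Projective P₀] [Projective P₁] [Projective P₂]
    (w : d₁ ≫ d₀ = 0) (n : ℕ) : Projective ((extendComplex d₀ d₁ w).X n) := by
  match n with
  | 0 => exact ‹Projective P₀›
  | 1 => exact ‹Projective P₁›
  | 2 => exact ‹Projective P₂›
  | n + 3 => apply Projective.projective_over

/-- A partial projective resolution of length two extends to a projective resolution. -/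
noncomputable def extendResolution [Projective P₀] [Projective P₁] [Projective P₂] [Epi ε]
    (w : d₁ ≫ d₀ = 0) (w₀ : d₀ ≫ ε = 0) (h : (ShortComplex.mk d₁ d₀ w).Exact)
    (h₀ : (ShortComplex.mk d₀ ε w₀).Exact) : ProjectiveResolution Z where
  complex := extendComplex d₀ d₁ w
  projective := extendComplex_projective d₀ d₁ w
  π := (ChainComplex.toSingle₀Equiv _ _).symm ⟨ε,
    (congrArg (· ≫ ε) (ChainComplex.mk_d_1_0 ..)).trans w₀⟩
  quasiIso := ⟨fun n => by
    -- In degree 0 the claim amounts to exactness at `P₀` together with `ε` being epi; in positive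
    -- degrees both complexes are exact.
    cases n
    · rw [ChainComplex.quasiIsoAt₀_iff, ShortComplex.quasiIso_iff_of_zeros']
      · refine (ShortComplex.exact_and_epi_g_iff_of_iso ?_).2 ⟨h₀, ‹Epi ε›⟩
        exact ShortComplex.isoMk (Iso.refl _) (Iso.refl _) (Iso.refl _)
          ((Category.id_comp _).trans ((Category.comp_id _).trans
            (ChainComplex.mk_d_1_0 ..)).symm)
          ((Category.id_comp _).trans (Eq.trans (Category.comp_id
            (((ChainComplex.toSingle₀Equiv (extendComplex d₀ d₁ w) Z).symm ⟨ε, _⟩).f 0))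
            (ChainComplex.toSingle₀Equiv_symm_apply_f_zero (C := extendComplex d₀ d₁ w) ..)).symm)
      all_goals rfl
    · rw [quasiIsoAt_iff_exactAt']
      · exact extendComplex_exactAt_succ d₀ d₁ w h _
      · apply ChainComplex.exactAt_succ_single_obj⟩

/-- The second left derived functor is a quotient of the second cycles of any partial
projective resolution of length two. -/
theorem exists_surjective_ker_leftDerived_two {k : Type*} [Ring k] (F : C ⥤ ModuleCat k)
    [F.Additive] [Projective P₀] [Projective P₁] [Projective P₂] [Epi ε]
    (w : d₁ ≫ d₀ = 0) (w₀ : d₀ ≫ ε = 0) (h : (ShortComplex.mk d₁ d₀ w).Exact)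
    (h₀ : (ShortComplex.mk d₀ ε w₀).Exact) :
    ∃ g : LinearMap.ker (F.map d₁).hom →ₗ[k] (F.leftDerived 2).obj Z, Function.Surjective g := by
  let P := extendResolution ε d₀ d₁ w w₀ h h₀
  let K := (F.mapHomologicalComplex _).obj P.complex
  have hd : P.complex.d 2 1 = d₁ := ChainComplex.mk_d_2_1 ..
  let e : (K.sc' 3 2 1).homology ≅ (F.leftDerived 2).obj Z :=
    ShortComplex.homologyMapIso (K.isoSc' 3 2 1 (by simp) (by simp)).symm ≪≫
      (P.isoLeftDerivedObj F 2).symm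
  have hK : (K.sc' 3 2 1).g = F.map d₁ := congrArg F.map hd
  let S := K.sc' 3 2 1
  -- Homology in degree 2 is a quotient of the cycles, and these depend only on the differential out
  -- of degree 2, so the chosen term in degree 3 plays no role.
  have hs : Function.Surjective (S.moduleCatCyclesIso.inv ≫ S.homologyπ ≫ e.hom).hom :=
    (ModuleCat.epi_iff_surjective _).1 inferInstance
  have key : ∃ g : LinearMap.ker S.g.hom →ₗ[k] (F.leftDerived 2).obj Z, Function.Surjective g :=
    ⟨_, hs⟩
  have hK' : S.g.hom = (F.map d₁).hom := congrArg ModuleCat.Hom.hom hK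
  obtain ⟨g, hg⟩ := key
  exact ⟨g.comp (LinearEquiv.ofEq _ _ (congrArg LinearMap.ker hK'.symm)).toLinearMap,
    hg.comp (LinearEquiv.surjective _)⟩

end PartialResolution

/-! ### Semidirect products and crossed homomorphisms -/

section CrossedPair

/-- The semidirect product of a monoid `M` with a representation `V` of it: pairs `(v, m)` with
`(v, m) (v', m') = (v + m v', m m')`. -/
@[ext]
structure CrossedPair {k M V : Type*} [CommRing k] [Monoid M] [AddCommGroup V] [Module k V]
    (ρ : Representation k M V) where
  /-- The component in the representation. -/
  vec : V
  /-- The component in the monoid. -/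
  act : M

variable {k M V W X : Type*} [CommRing k] [Monoid M] [AddCommGroup V] [Module k V]
  [AddCommGroup W] [Module k W] {ρ : Representation k M V} {σ : Representation k M W}

namespace CrossedPair

instance : Mul (CrossedPair ρ) := ⟨fun p q => ⟨p.vec + ρ p.act q.vec, p.act * q.act⟩⟩

instance : One (CrossedPair ρ) := ⟨⟨0, 1⟩⟩

@[simp] lemma mul_vec (p q : CrossedPair ρ) : (p * q).vec = p.vec + ρ p.act q.vec := rfl
@[simp] lemma mul_act (p q : CrossedPair ρ) : (p * q).act = p.act * q.act := rfl
@[simp] lemma one_vec : (1 : CrossedPair ρ).vec = 0 := rfl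
@[simp] lemma one_act : (1 : CrossedPair ρ).act = 1 := rfl

instance : Monoid (CrossedPair ρ) where
  mul_assoc p q r := by ext <;> simp [mul_assoc, add_assoc]
  one_mul p := by ext <;> simp
  mul_one p := by ext <;> simp

/-- The projection of the semidirect product onto the monoid. -/
def actHom (ρ : Representation k M V) : CrossedPair ρ →* M where
  toFun := act
  map_one' := rfl
  map_mul' _ _ := rfl

@[simp] lemma actHom_apply (p : CrossedPair ρ) : actHom ρ p = p.act := rfl

/-- Functoriality of the semidirect product in the representation. -/
def map (f : ρ.IntertwiningMap σ) : CrossedPair ρ →* CrossedPair σ where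
  toFun p := ⟨f p.vec, p.act⟩
  map_one' := by ext <;> simp
  map_mul' p q := by ext <;> simp [f.isIntertwining]

@[simp] lemma map_apply (f : ρ.IntertwiningMap σ) (p : CrossedPair ρ) :
    map f p = ⟨f p.vec, p.act⟩ := rfl

/-- The projection of the semidirect product onto the coinvariants of the representation. -/
def toCoinvariants (ρ : Representation k M V) :
    CrossedPair ρ →* Multiplicative ρ.Coinvariants where
  toFun p := Multiplicative.ofAdd (Representation.Coinvariants.mk ρ p.vec)
  map_one' := by simp
  map_mul' p q := by simp

/-- The monoid homomorphism from the free monoid on `X` that sends `x` to `(v x, a x)`. Its first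
component is the crossed homomorphism (Fox derivative) with values `v x`. -/
def ofWord (ρ : Representation k M V) (a : X → M) (v : X → V) : FreeMonoid X →* CrossedPair ρ :=
  FreeMonoid.lift fun x => ⟨v x, a x⟩

@[simp] lemma ofWord_of (a : X → M) (v : X → V) (x : X) :
    ofWord ρ a v (FreeMonoid.of x) = ⟨v x, a x⟩ := FreeMonoid.lift_eval_of _ _

@[simp] lemma ofWord_act (a : X → M) (v : X → V) (w : FreeMonoid X) :
    (ofWord ρ a v w).act = FreeMonoid.lift a w :=
  DFunLike.congr_fun (f := (actHom ρ).comp (ofWord ρ a v)) (FreeMonoid.hom_eq (by simp)) w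

/-- Lets Fox derivatives be pushed to a quotient representation. -/
lemma map_ofWord (f : ρ.IntertwiningMap σ) (a : X → M) (v : X → V) (w : FreeMonoid X) :
    (ofWord σ a (f ∘ v) w).vec = f (ofWord ρ a v w).vec :=
  congrArg vec (DFunLike.congr_fun (g := (map f).comp (ofWord ρ a v))
    (FreeMonoid.hom_eq (by simp)) w)

/-- The action becomes trivial on coinvariants, so a crossed homomorphism turns into an ordinary
one, determined by its values on letters. -/
lemma mk_ofWord (a : X → M) (v : X → V) (w : FreeMonoid X) :
    FreeMonoid.lift (fun x => Multiplicative.ofAdd (Representation.Coinvariants.mk ρ (v x))) w =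
      Multiplicative.ofAdd (Representation.Coinvariants.mk ρ (ofWord ρ a v w).vec) :=
  DFunLike.congr_fun (g := (toCoinvariants ρ).comp (ofWord ρ a v))
    (FreeMonoid.hom_eq (by simp [toCoinvariants])) w

end CrossedPair

end CrossedPair

/-! ### The Fox resolution of a presented monoid -/

/-- The monoid `M` is presented by the generators `a x` and the relations `r y = s y`, in the form
of a universal property. -/
structure IsPresentedBy {X Y : Type*} {M : Type v} [Monoid M] (a : X → M)
    (r s : Y → FreeMonoid X) : Prop where
  closure_range : Submonoid.closure (Set.range a) = ⊤
  rel : ∀ y, FreeMonoid.lift a (r y) = FreeMonoid.lift a (s y)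
  exists_hom : ∀ (N : Type v) [Monoid N] (f : X → N),
    (∀ y, FreeMonoid.lift f (r y) = FreeMonoid.lift f (s y)) → ∃ φ : M →* N, ∀ x, φ (a x) = f x

lemma Rep.exact_of_ker_le {k : Type u} {M : Type v} [CommRing k] [Monoid M]
    {A B C : Rep.{w} k M} (f : A ⟶ B) (g : B ⟶ C) (w : f ≫ g = 0)
    (h : ∀ b : B.V, g.hom b = 0 → ∃ a : A.V, f.hom a = b) : (ShortComplex.mk f g w).Exact := by
  apply (forget₂ _ (ModuleCat k)).reflects_exact_of_faithful
  exact (ShortComplex.moduleCat_exact_iff _).2 h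

namespace FoxResolution

open Representation Finsupp

variable {X Y M : Type v} [Monoid M]

/-- The basis element of the free `ℤM`-module on `X` belonging to `x`. -/
noncomputable abbrev basisVec (M : Type v) [Monoid M] {X : Type v} (x : X) :
    X →₀ MonoidAlgebra ℤ M :=
  single x (.single 1 1)

variable (M) in
/-- The augmentation `ℤM ⟶ ℤ`. -/
noncomputable abbrev augmentation :
    Rep.free ℤ M PUnit.{v+1} ⟶ Rep.trivial ℤ M (ULift.{v} ℤ) :=
  Rep.freeLift ℤ M _ fun _ => ULift.up 1

/-- The differential `ℤM[X] ⟶ ℤM`, sending the basis element of `x` to `x - 1`. -/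
noncomputable abbrev d₀ (a : X → M) : Rep.free ℤ M X ⟶ Rep.free ℤ M PUnit.{v+1} :=
  Rep.freeLift ℤ M _ fun x => single PUnit.unit (.single (a x) 1 - .single 1 1)

/-- The Fox derivative of a word, with values in the free `ℤM`-module on the letters. -/
noncomputable def fox (a : X → M) (w : FreeMonoid X) : X →₀ MonoidAlgebra ℤ M :=
  (CrossedPair.ofWord (Representation.free ℤ M X) a (basisVec M) w).vec

/-- The differential `ℤM[Y] ⟶ ℤM[X]`, sending the basis element of a relation to the difference
of the Fox derivatives of its two sides. -/
noncomputable abbrev d₁ (a : X → M) (r s : Y → FreeMonoid X) : Rep.free ℤ M Y ⟶ Rep.free ℤ M X :=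
  Rep.freeLift ℤ M _ fun y => fox a (r y) - fox a (s y)

variable {a : X → M} {r s : Y → FreeMonoid X}

lemma d₀_comp_augmentation (a : X → M) : d₀ a ≫ augmentation M = 0 := by
  apply Rep.free_ext
  intro x
  simp

/-- The fundamental formula of Fox calculus: the product rule for `fox` matches uv - 1 = (u - 1) +
u(v - 1). -/
lemma d₀_fox (a : X → M) (w : FreeMonoid X) :
    (d₀ a).hom (fox a w) = single PUnit.unit (.single (FreeMonoid.lift a w) 1 - .single 1 1) := by
  induction w with
  | one => simp [fox]
  | of x => simp [fox]
  | mul x y hx hy =>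
    have : fox a (x * y) = fox a x + free ℤ M X (FreeMonoid.lift a x) (fox a y) := by
      simp [fox]
    rw [this, map_add, hx, Rep.hom_comm_apply, hy]
    simp

lemma d₁_comp_d₀ (h : ∀ y, FreeMonoid.lift a (r y) = FreeMonoid.lift a (s y)) :
    d₁ a r s ≫ d₀ a = 0 := by
  apply Rep.free_ext
  intro x
  have h' := (congrArg₂ (· - ·) (d₀_fox a (r x)) (d₀_fox a (s x))).trans
    (by rw [h x, sub_self])
  simpa using h'

/-- Modulo the image of `d₀` every m ∈ M equals 1, so the quotient map factors through the
augmentation, whose kernel therefore lies in that image. -/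
lemma exact_d₀_augmentation (h : Submonoid.closure (Set.range a) = ⊤) :
    (ShortComplex.mk (d₀ a) (augmentation M) (d₀_comp_augmentation a)).Exact := by
  refine Rep.exact_of_ker_le _ _ _ fun b hb => ?_
  let R : Submodule ℤ (PUnit.{v+1} →₀ MonoidAlgebra ℤ M) :=
    LinearMap.range (d₀ a).hom.toLinearMap
  have hR (m : M) : single PUnit.unit (.single m 1 - .single 1 1) ∈ R := by
    obtain ⟨w, rfl⟩ : ∃ w, FreeMonoid.lift a w = m := by
      rw [← MonoidHom.mem_mrange, FreeMonoid.mrange_lift, h]; trivial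
    exact ⟨fox a w, d₀_fox a w⟩
  let c : ULift.{v} ℤ →ₗ[ℤ] (PUnit.{v+1} →₀ MonoidAlgebra ℤ M) ⧸ R :=
    (LinearMap.toSpanSingleton ℤ _ (R.mkQ (basisVec M PUnit.unit))) ∘ₗ
      ULift.moduleEquiv.toLinearMap
  have key : R.mkQ = c ∘ₗ (augmentation M).hom.toLinearMap := by
    ext u m
    have h1 : R.mkQ (single PUnit.unit (.single m 1)) = R.mkQ (basisVec M PUnit.unit) := by
      refine (Submodule.Quotient.eq R).2 ?_
      rw [← single_sub]
      exact hR m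
    simpa [c] using h1
  exact (Submodule.Quotient.mk_eq_zero R).1 <|
    (LinearMap.congr_fun key b).trans ((congrArg c hb).trans (map_zero c))

/-- Modulo the image R of `d₁`, the Fox derivative respects the relations and so descends to a
crossed homomorphism on M. Its linear extension t to ℤM satisfies t ∘ `d₀` = (quotient map by R),
which puts ker `d₀` inside R. -/
lemma exact_d₁_d₀ (h : IsPresentedBy a r s) :
    (ShortComplex.mk (d₁ a r s) (d₀ a) (d₁_comp_d₀ h.rel)).Exact := by
  refine Rep.exact_of_ker_le _ _ _ fun b hb => ?_
  let R : Submodule ℤ (X →₀ MonoidAlgebra ℤ M) := LinearMap.range (d₁ a r s).hom.toLinearMap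
  let σ := Representation.quotient (Representation.free ℤ M X) R <| by
    rintro g _ ⟨y, rfl⟩
    exact ⟨Representation.free ℤ M Y g y, Rep.hom_comm_apply (d₁ a r s) g y⟩
  let q : (Representation.free ℤ M X).IntertwiningMap σ :=
    { toLinearMap := R.mkQ, isIntertwining' := fun g => rfl }
  have hq (w : FreeMonoid X) :
      CrossedPair.ofWord σ a (q ∘ basisVec M) w = ⟨q (fox a w), FreeMonoid.lift a w⟩ := by
    ext
    · exact CrossedPair.map_ofWord ..
    · simp
  -- A crossed homomorphism on M is a homomorphism to the semidirect product splitting the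
  -- projection, so the universal property of the presentation provides it.
  obtain ⟨φ, hφ⟩ := h.exists_hom (CrossedPair σ) (fun x => ⟨q (basisVec M x), a x⟩) fun y => by
    refine (hq _).trans (Eq.trans ?_ (hq _).symm)
    rw [h.rel y]
    congr 1
    refine (Submodule.Quotient.eq R).2 ⟨basisVec M y, ?_⟩
    simp
  have hact (m : M) : (φ m).act = m :=
    DFunLike.congr_fun (f := (CrossedPair.actHom σ).comp φ) (g := MonoidHom.id M)
      (MonoidHom.eq_of_eqOn_denseM h.closure_range (by rintro _ ⟨x, rfl⟩; simp [hφ])) m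
  let t : (PUnit.{v+1} →₀ MonoidAlgebra ℤ M) →ₗ[ℤ] (X →₀ MonoidAlgebra ℤ M) ⧸ R :=
    lsum ℤ fun _ => (Finsupp.linearCombination ℤ fun m => (φ m).vec) ∘ₗ
      (MonoidAlgebra.coeffLinearEquiv ℤ).toLinearMap
  have key : R.mkQ = t ∘ₗ (d₀ a).hom.toLinearMap := by
    ext x m
    have h1 : q (single x (.single m 1)) = σ m (q (basisVec M x)) := by
      rw [← q.isIntertwining]
      simp
    -- The crossed rule at m · x says that t(mx) - t(m) is m times the class of the basis vector of
    -- x.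
    have h2 := congrArg CrossedPair.vec (map_mul φ m (a x))
    rw [CrossedPair.mul_vec, hact, hφ, ← h1] at h2
    have ht (m : M) : t (single PUnit.unit (.single m 1)) = (φ m).vec := by simp [t]
    have h3 : (d₀ a).hom.toLinearMap (single x (.single m 1)) =
        single PUnit.unit (.single (m * a x) 1) - single PUnit.unit (.single m 1) := by simp
    change q (single x (.single m 1)) = t ((d₀ a).hom.toLinearMap (single x (.single m 1)))
    rw [h3, map_sub, ht, ht, h2, add_sub_cancel_left]
  exact (Submodule.Quotient.mk_eq_zero R).1 <|
    (LinearMap.congr_fun key b).trans ((congrArg t hb).trans (map_zero t))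

instance : Epi (augmentation M) := by
  rw [Rep.epi_iff_surjective]
  intro x
  exact ⟨single PUnit.unit (.single 1 x.down), by simp; ext; simp⟩

end FoxResolution

/-! ### Coinvariants of free modules and the count of generators -/

namespace Representation

open Finsupp

variable (k M X : Type*) [CommRing k] [Monoid M]

/-- The coinvariants of the free `kM`-module on `X` are the free `k`-module on `X`. -/
noncomputable def coinvariantsFreeLEquiv : (free k M X).Coinvariants ≃ₗ[k] (X →₀ k) :=
  let f := freeLift (trivial k M (X →₀ k)) fun x => single x 1
  LinearEquiv.ofLinearMap
    (Coinvariants.lift _ f.toLinearMap fun g => f.isIntertwining' g)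
    (Finsupp.linearCombination k fun x => Coinvariants.mk _ (single x (.single 1 1)))
    (by ext; simp [f])
    (by
      ext x m
      have := Coinvariants.mk_self_apply (free k M X) m (single x (.single 1 1))
      simpa [f] using this.symm)

lemma span_range_mk_single :
    Submodule.span k (Set.range fun x : X =>
      Coinvariants.mk (free k M X) (single x (.single 1 1))) = ⊤ := by
  rw [← Finsupp.range_linearCombination]
  exact LinearMap.range_eq_top.2 (coinvariantsFreeLEquiv k M X).symm.surjective

end Representation

/-- A quotient of a finite free module of rank `n` is generated by `n` elements. -/
lemma AddGroup.exists_fg_rank_le_finrank {K H : Type*} [AddCommGroup K] [AddCommGroup H]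
    [Module.Free ℤ K] [Module.Finite ℤ K] (g : K →+ H) (hg : Function.Surjective g) :
    ∃ _ : AddGroup.FG H, AddGroup.rank H ≤ Module.finrank ℤ K := by
  classical
  let b := Module.finBasis ℤ K
  have hs : AddSubgroup.closure (((Finset.univ.image fun i => g (b i)) : Finset H) : Set H) = ⊤ := by
    have h1 : AddSubgroup.closure (Set.range b) = ⊤ := by
      rw [← Submodule.span_int_eq_addSubgroupClosure, b.span_eq]; rfl
    have h2 := AddMonoidHom.map_closure g (Set.range b)
    rw [h1, ← AddMonoidHom.range_eq_map, AddMonoidHom.range_eq_top.2 hg] at h2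
    rw [h2]
    congr 1
    ext; simp
  have hfg : AddGroup.FG H := ⟨⟨_, hs⟩⟩
  refine ⟨hfg, (AddGroup.rank_le hs).trans (Finset.card_image_le.trans ?_)⟩
  simp

namespace FoxResolution

open Representation

variable {X Y M : Type v} [Monoid M] {a : X → M} {r s : Y → FreeMonoid X}

/-- The second homology of a presented monoid is generated by `|Y| - |X| + rk Q` elements, where
`Q` is the abelian group with the same presentation. -/
theorem exists_rank_monoidHomology_two_le [Finite X] [Finite Y] (h : IsPresentedBy a r s) :
    ∃ (Q : Type v) (_ : AddCommGroup Q) (q : X → Q), Submodule.span ℤ (Set.range q) = ⊤ ∧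
      (∀ y, FreeMonoid.lift (fun x => Multiplicative.ofAdd (q x)) (r y) =
        FreeMonoid.lift (fun x => Multiplicative.ofAdd (q x)) (s y)) ∧
      ∃ _ : AddGroup.FG (monoidHomology 2 M),
        AddGroup.rank (monoidHomology 2 M) + Nat.card X ≤ Nat.card Y + Module.finrank ℤ Q := by
  obtain ⟨g, hg⟩ := exists_surjective_ker_leftDerived_two (augmentation M) (d₀ a) (d₁ a r s)
    (Rep.coinvariantsFunctor.{v} ℤ M) (d₁_comp_d₀ h.rel) (d₀_comp_augmentation a)
    (exact_d₁_d₀ h) (exact_d₀_augmentation h.closure_range)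
  let AX := (Representation.free ℤ M X).Coinvariants
  let AY := (Representation.free ℤ M Y).Coinvariants
  let eX : AX ≃ₗ[ℤ] (X →₀ ℤ) := coinvariantsFreeLEquiv ℤ M X
  let eY : AY ≃ₗ[ℤ] (Y →₀ ℤ) := coinvariantsFreeLEquiv ℤ M Y
  let D : AY →ₗ[ℤ] AX := Coinvariants.map _ _ (d₁ a r s).hom
  have : Module.Finite ℤ AX := Module.Finite.equiv eX.symm
  have : Module.Finite ℤ AY := Module.Finite.equiv eY.symm
  have : Module.Free ℤ AX := Module.Free.of_equiv eX.symm
  have : Module.Free ℤ AY := Module.Free.of_equiv eY.symm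
  have hX : Module.finrank ℤ AX = Nat.card X := by
    have := Fintype.ofFinite X
    rw [eX.finrank_eq, Module.finrank_finsupp_self, Nat.card_eq_fintype_card]
  have hY : Module.finrank ℤ AY = Nat.card Y := by
    have := Fintype.ofFinite Y
    rw [eY.finrank_eq, Module.finrank_finsupp_self, Nat.card_eq_fintype_card]
  -- `D` is, by definition, the coinvariants functor applied to `d₁`.
  let g' : LinearMap.ker D →ₗ[ℤ] monoidHomology 2 M := g
  have hg' : Function.Surjective g' := hg
  let m : (Representation.free ℤ M X).Coinvariants →+ AX ⧸ LinearMap.range D :=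
    (LinearMap.range D).mkQ.toAddMonoidHom
  refine ⟨AX ⧸ LinearMap.range D, inferInstance,
    fun x => (LinearMap.range D).mkQ (Coinvariants.mk _ (basisVec M x)), ?_, fun y => ?_, ?_⟩
  · rw [Set.range_comp', Submodule.span_image, show Submodule.span ℤ (Set.range fun x =>
      Coinvariants.mk (Representation.free ℤ M X) (basisVec M x)) = ⊤ from
      span_range_mk_single ℤ M X, Submodule.map_top, Submodule.range_mkQ]
  -- Evaluating a word in the cokernel of `D` gives the class of its Fox derivative, so the two
  -- sides of a relation differ by a value of `D`.
  · have key (w : FreeMonoid X) : FreeMonoid.lift (fun x => Multiplicative.ofAdd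
        ((LinearMap.range D).mkQ (Coinvariants.mk _ (basisVec M x)))) w =
        Multiplicative.ofAdd ((LinearMap.range D).mkQ (Coinvariants.mk _ (fox a w))) :=
      (DFunLike.congr_fun (g := m.toMultiplicative.comp (FreeMonoid.lift _))
        (FreeMonoid.hom_eq fun x => by simp [m]) w).trans
        (congrArg m.toMultiplicative (CrossedPair.mk_ofWord a (basisVec M) w))
    rw [key, key]
    refine congrArg Multiplicative.ofAdd
      ((Submodule.Quotient.eq _).2 ⟨Coinvariants.mk _ (basisVec M y), ?_⟩)
    change Coinvariants.mk _ ((d₁ a r s).hom (basisVec M y)) =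
      Coinvariants.mk _ (fox a (r y) - fox a (s y))
    simp
  · obtain ⟨hfg, hle⟩ := AddGroup.exists_fg_rank_le_finrank g'.toAddMonoidHom hg'
    refine ⟨hfg, ?_⟩
    -- Rank-nullity twice: rk ker D + rk im D = |Y| and rk im D + rk coker D = |X|.
    have h1 := (LinearMap.ker D).finrank_quotient_add_finrank
    rw [D.quotKerEquivRange.finrank_eq] at h1
    have h2 := (LinearMap.range D).finrank_quotient_add_finrank
    omega

end FoxResolution

/-! ### Ranks of abelian quotients and homomorphisms to ℤ -/

lemma abelianizationRank_eq (G : Type u) [Group G] :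
    abelianizationRank G = Module.finrank ℤ (Additive (Abelianization G)) :=
  (TensorProduct.isBaseChange ℤ (Additive (Abelianization G)) ℚ).finrank_eq

/-- A map onto an abelian group factors through the abelianization, and rank does not grow under
surjections of finitely generated abelian groups. -/
lemma finrank_le_abelianizationRank {G : Type u} [Group G] [Group.FG G] {Q : Type v}
    [AddCommGroup Q] (f : G →* Multiplicative Q) (hf : Function.Surjective f) :
    Module.finrank ℤ Q ≤ abelianizationRank G := by
  have hfg : Group.FG (Abelianization G) :=
    Group.fg_of_surjective (f := Abelianization.of) QuotientGroup.mk_surjective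
  have : Module.Finite ℤ (Additive (Abelianization G)) :=
    Module.Finite.iff_addGroup_fg.2 (GroupFG.iff_add_fg.1 hfg)
  let g : Additive (Abelianization G) →+ Q := (Abelianization.lift f).toAdditiveLeft
  have hg : Function.Surjective g.toIntLinearMap := fun q =>
    let ⟨x, hx⟩ := hf (Multiplicative.ofAdd q)
    ⟨Additive.ofMul (Abelianization.of x), congrArg Multiplicative.toAdd hx⟩
  rw [abelianizationRank_eq]
  exact LinearMap.finrank_le_finrank_of_surjective hg

/-- An abelian group with generators `q x` that satisfy the relators `rels` has rank at most that
of the abelianization of the group presented by `rels`. -/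
lemma finrank_le_abelianizationRank_presentedGroup {X : Type u} [Finite X]
    (rels : Set (FreeGroup X)) {Q : Type v} [AddCommGroup Q] (q : X → Q)
    (hq : Submodule.span ℤ (Set.range q) = ⊤)
    (h : ∀ g ∈ rels, FreeGroup.lift (fun x => Multiplicative.ofAdd (q x)) g = 1) :
    Module.finrank ℤ Q ≤ abelianizationRank (PresentedGroup rels) := by
  have : Group.FG (PresentedGroup rels) :=
    Group.fg_of_surjective (PresentedGroup.mk_surjective rels)
  refine finrank_le_abelianizationRank (PresentedGroup.toGroup h) fun y => ?_
  have hs : Submodule.span ℤ (Set.range q) ≤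
      AddSubgroup.toIntSubmodule (PresentedGroup.toGroup h).range.toAddSubgroup' := by
    rw [Submodule.span_le]
    rintro _ ⟨x, rfl⟩
    exact ⟨PresentedGroup.of x, PresentedGroup.toGroup.of h⟩
  exact hs (hq ▸ Submodule.mem_top : y.toAdd ∈ _)

/-- A finitely generated abelian group of positive rank has a nonzero homomorphism to `ℤ`. -/
lemma finrank_eq_zero_of_forall_dual_eq_zero {Q : Type*} [AddCommGroup Q] [Module.Finite ℤ Q]
    (h : ∀ f : Q →ₗ[ℤ] ℤ, f = 0) : Module.finrank ℤ Q = 0 := by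
  rw [Module.finrank_eq_zero_iff_isTorsion]
  intro x
  let T := Submodule.torsion ℤ Q
  -- The quotient by torsion is finitely generated and torsion-free, hence free, so its functionals
  -- separate points; each pulls back to a functional on Q.
  have hx : T.mkQ x = 0 := by
    refine (Module.forall_dual_apply_eq_zero_iff ℤ (T.mkQ x)).1 fun f => ?_
    exact LinearMap.congr_fun (h (f ∘ₗ T.mkQ)) x
  exact (Submodule.Quotient.mk_eq_zero T).1 hx

/-- Two distinct powers of m coincide, and ℤ is torsion-free. -/
lemma MonoidHom.eq_one_of_finite {M : Type*} [Monoid M] [Finite M] (f : M →* Multiplicative ℤ) :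
    f = 1 := by
  ext m
  obtain ⟨i, j, hij, hne⟩ : ∃ i j : ℕ, m ^ i = m ^ j ∧ i ≠ j := by
    simpa [Function.Injective] using not_injective_infinite_finite (fun n : ℕ => m ^ n)
  have h : (i : ℤ) * (f m).toAdd = j * (f m).toAdd := by
    simpa using congrArg (fun x => (f x).toAdd) hij
  have h' : ((i : ℤ) - j) * (f m).toAdd = 0 := by linarith
  rcases mul_eq_zero.1 h' with h0 | h0
  · omega
  · exact h0

lemma FreeMonoid.lift_map_apply {α β N : Type*} [Monoid N] (e : α → β) (f : β → N)
    (w : FreeMonoid α) : FreeMonoid.lift f (FreeMonoid.map e w) = FreeMonoid.lift (f ∘ e) w :=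
  DFunLike.congr_fun (f := (FreeMonoid.lift f).comp (FreeMonoid.map e))
    (FreeMonoid.hom_eq fun x => by simp) w

/-! ### Pride's inequalities in terms of the universal property -/

namespace IsPresentedBy

variable {X : Type u} {Y : Type w} {M : Type v} [Monoid M] {a : X → M} {r s : Y → FreeMonoid X}

/-- Change of the index types of generators and relations. -/
lemma reindex (h : IsPresentedBy a r s) {X' Y' : Type*} (e : X ≃ X') (e' : Y' ≃ Y) :
    IsPresentedBy (a ∘ e.symm) (fun y => FreeMonoid.map e (r (e' y)))
      (fun y => FreeMonoid.map e (s (e' y))) where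
  closure_range := by rw [e.symm.surjective.range_comp, h.closure_range]
  rel y := by simp [FreeMonoid.lift_map_apply, Function.comp_assoc, h.rel]
  exists_hom N _ f hf := by
    obtain ⟨φ, hφ⟩ := h.exists_hom N (f ∘ e) fun y => by
      simpa [FreeMonoid.lift_map_apply] using hf (e'.symm y)
    exact ⟨φ, fun x => by simp [hφ]⟩

theorem exists_rank_monoidHomology_two_le [Finite X] [Finite Y] (h : IsPresentedBy a r s) :
    ∃ (Q : Type v) (_ : AddCommGroup Q) (q : X → Q), Submodule.span ℤ (Set.range q) = ⊤ ∧
      (∀ y, FreeMonoid.lift (fun x => Multiplicative.ofAdd (q x)) (r y) =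
        FreeMonoid.lift (fun x => Multiplicative.ofAdd (q x)) (s y)) ∧
      ∃ _ : AddGroup.FG (monoidHomology 2 M),
        AddGroup.rank (monoidHomology 2 M) + Nat.card X ≤ Nat.card Y + Module.finrank ℤ Q := by
  -- The Fox resolution needs X, Y and M in one universe; finite index types can be replaced by
  -- lifted copies of `Fin`.
  let e : X ≃ ULift.{v} (Fin (Nat.card X)) := (Finite.equivFin X).trans Equiv.ulift.symm
  let e' : Y ≃ ULift.{v} (Fin (Nat.card Y)) := (Finite.equivFin Y).trans Equiv.ulift.symm
  obtain ⟨Q, hQ, q, hq, hrel, hfg, hle⟩ :=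
    FoxResolution.exists_rank_monoidHomology_two_le (h.reindex e e'.symm)
  refine ⟨Q, inferInstance, q ∘ e, ?_, fun y => ?_, hfg, ?_⟩
  · rwa [e.surjective.range_comp]
  · simpa [FreeMonoid.lift_map_apply, Function.comp_def] using hrel (e' y)
  · simpa using hle

/-- Pride's inequalities for a monoid given by a finite presentation. -/
theorem rank_monoidHomology_two_le [Finite X] [Finite Y] (h : IsPresentedBy a r s)
    (rels : Set (FreeGroup X)) (hrels : ∀ g ∈ rels, ∃ y,
      g = FreeMonoid.lift FreeGroup.of (r y) * (FreeMonoid.lift FreeGroup.of (s y))⁻¹) :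
    ∃ _ : AddGroup.FG (monoidHomology 2 M),
      AddGroup.rank (monoidHomology 2 M) + Nat.card X ≤
        Nat.card Y + abelianizationRank (PresentedGroup rels) ∧
      ((∀ f : M →* Multiplicative ℤ, f = 1) →
        AddGroup.rank (monoidHomology 2 M) + Nat.card X ≤ Nat.card Y) := by
  obtain ⟨Q, hQ, q, hq, hrel, hfg, hle⟩ := h.exists_rank_monoidHomology_two_le
  refine ⟨hfg, hle.trans (Nat.add_le_add_left ?_ _), fun hM => hle.trans_eq ?_⟩
  · refine finrank_le_abelianizationRank_presentedGroup rels q hq fun g hg => ?_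
    obtain ⟨y, rfl⟩ := hrels g hg
    have key (w : FreeMonoid X) :
        FreeGroup.lift (fun x => Multiplicative.ofAdd (q x)) (FreeMonoid.lift FreeGroup.of w) =
          FreeMonoid.lift (fun x => Multiplicative.ofAdd (q x)) w :=
      DFunLike.congr_fun (f := (FreeGroup.lift _).comp (FreeMonoid.lift FreeGroup.of))
        (FreeMonoid.hom_eq fun x => by simp) w
    rw [map_mul, map_inv, key, key, hrel y, mul_inv_cancel]
  · have : Module.Finite ℤ Q := ⟨⟨(Set.finite_range q).toFinset, by simpa using hq⟩⟩
    -- The relations hold in Q, so M maps to Q; a functional on Q composed with this map is trivial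
    -- by assumption, hence vanishes on the generators of Q.
    obtain ⟨χ, hχ⟩ := h.exists_hom (Multiplicative Q) _ hrel
    rw [finrank_eq_zero_of_forall_dual_eq_zero, add_zero]
    intro f
    refine LinearMap.ext_on_range hq fun x => ?_
    have hx := DFunLike.congr_fun (hM (f.toAddMonoidHom.toMultiplicative.comp χ)) (a x)
    simpa [hχ] using hx

end IsPresentedBy

/-! ### From concrete presentations to the universal property, and the theorem -/

lemma IsMonoidPresentation.exists_isPresentedBy {X : Type u}
    {R : Finset (FreeMonoid X × FreeMonoid X)} {M : Type v} [Monoid M]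
    (h : IsMonoidPresentation R M) :
    ∃ a : X → M, IsPresentedBy a (fun p : R => p.1.1) (fun p : R => p.1.2) := by
  obtain ⟨e⟩ := h
  have hlift (w : FreeMonoid X) : FreeMonoid.lift (fun x => e (PresentedMonoid.of _ x)) w =
      e (PresentedMonoid.mk _ w) :=
    DFunLike.congr_fun (f := FreeMonoid.lift _) (g := e.toMonoidHom.comp (PresentedMonoid.mk _))
      (FreeMonoid.hom_eq fun x => rfl) w
  refine ⟨fun x => e (PresentedMonoid.of _ x), ?_, fun p => ?_, fun N _ f hf => ?_⟩
  · rw [Set.range_comp' e, ← MulEquiv.coe_toMonoidHom, ← MonoidHom.map_mclosure,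
      PresentedMonoid.closure_range_of, ← MonoidHom.mrange_eq_map, MonoidHom.mrange_eq_top]
    exact e.surjective
  · rw [hlift, hlift]
    exact congrArg e (PresentedMonoid.mk_eq_mk_of_rel p.2)
  · exact ⟨(PresentedMonoid.lift f fun u v huv => hf ⟨(u, v), huv⟩).comp e.symm.toMonoidHom,
      fun x => by simp⟩

lemma FreeSemigroup.lift_toFreeMonoid {X N : Type*} [Monoid N] (f : X → N)
    (w : FreeSemigroup X) : FreeMonoid.lift f w.toFreeMonoid = FreeSemigroup.lift f w :=
  DFunLike.congr_fun (f := (FreeMonoid.lift f).toMulHom.comp FreeSemigroup.toFreeMonoid)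
    (FreeSemigroup.hom_ext (by ext; simp)) w

/-- Reduces semigroups to monoids: monoid homomorphisms out of S¹ are semigroup homomorphisms out of
S, so no new generator or relation is needed. -/
lemma IsSemigroupPresentation.exists_isPresentedBy {X : Type u}
    {R : Finset (FreeSemigroup X × FreeSemigroup X)} {S : Type v} [Semigroup S]
    (h : IsSemigroupPresentation R S) :
    ∃ a : X → WithOne S, IsPresentedBy a (fun p : R => p.1.1.toFreeMonoid)
      (fun p : R => p.1.2.toFreeMonoid) := by
  obtain ⟨e⟩ := h
  let c := conGen (fun a b : FreeSemigroup X => (a, b) ∈ R)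
  let π : FreeSemigroup X →ₙ* S := (e : c.Quotient →ₙ* S).comp c.mkMulHom
  have hπ : Function.Surjective π := e.surjective.comp Quotient.mk_surjective
  let a : X → WithOne S := fun x => (π (FreeSemigroup.of x) : S)
  have hlift (w : FreeSemigroup X) : FreeMonoid.lift a w.toFreeMonoid = (π w : WithOne S) := by
    rw [FreeSemigroup.lift_toFreeMonoid]
    exact DFunLike.congr_fun (f := FreeSemigroup.lift a) (g := WithOne.coeMulHom.comp π) (FreeSemigroup.hom_ext rfl) w
  refine ⟨a, ?_, fun p => ?_, fun N _ f hf => ?_⟩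
  · rw [← FreeMonoid.mrange_lift, MonoidHom.mrange_eq_top]
    intro m
    induction m with
    | one => exact ⟨1, map_one _⟩
    | coe m =>
      obtain ⟨w, rfl⟩ := hπ m
      exact ⟨_, hlift w⟩
  · rw [hlift, hlift]
    exact congrArg (fun z => (e z : WithOne S)) ((Con.eq c).2 (ConGen.Rel.of _ _ p.2))
  · have hc : c ≤ Con.ker (FreeSemigroup.lift f) := Con.conGen_le.2 fun u v huv => by
      simpa [FreeSemigroup.lift_toFreeMonoid] using hf ⟨(u, v), huv⟩
    let g : c.Quotient →ₙ* N :=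
      { toFun := fun z => Con.liftOn z (FreeSemigroup.lift f) hc
        map_mul' := fun y z => Con.induction_on₂ y z fun _ _ => map_mul _ _ _ }
    refine ⟨WithOne.lift (g.comp (e.symm : S →ₙ* c.Quotient)), fun x => ?_⟩
    have : e.symm (π (FreeSemigroup.of x)) = c.mkMulHom (FreeSemigroup.of x) :=
      e.symm_apply_apply _
    simp only [a, WithOne.lift_coe]
    exact congrArg g this

lemma WithOne.monoidHom_eq_one {S : Type*} [Semigroup S]
    (h : ∀ f : S →ₙ* Multiplicative ℤ, ∀ s, f s = 1) (f : WithOne S →* Multiplicative ℤ) :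
    f = 1 := by
  ext m
  induction m with
  | one => simp
  | coe m => exact congrArg Multiplicative.toAdd (h (f.toMulHom.comp WithOne.coeMulHom) m)

/-- Pride's theorem and its corollary, for monoids and for semigroups. `AddGroup.rank A` is the
minimum number of generators of the finitely generated group `A`. -/
theorem mainTheorem4 :
    (∀ (X : Type u) [Fintype X] (R : Finset (FreeMonoid X × FreeMonoid X))
        (M : Type v) [Monoid M], IsMonoidPresentation R M →
      ∃ _ : AddGroup.FG (monoidHomology 2 M),
        (R.card : ℤ) - (Fintype.card X : ℤ) ≥
          (AddGroup.rank (monoidHomology 2 M) : ℤ)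
            - (abelianizationRank (MonoidPresentationGroup R) : ℤ) ∧
        ((Finite M ∨ ∀ f : M →* Multiplicative ℤ, f = 1) →
          (R.card : ℤ) - (Fintype.card X : ℤ) ≥ (AddGroup.rank (monoidHomology 2 M) : ℤ))) ∧
    (∀ (X : Type u) [Fintype X] (R : Finset (FreeSemigroup X × FreeSemigroup X))
        (S : Type v) [Semigroup S], IsSemigroupPresentation R S →
      ∃ _ : AddGroup.FG (semigroupHomology 2 S),
        (R.card : ℤ) - (Fintype.card X : ℤ) ≥
          (AddGroup.rank (semigroupHomology 2 S) : ℤ)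
            - (abelianizationRank (SemigroupPresentationGroup R) : ℤ) ∧
        ((Finite S ∨ ∀ f : S →ₙ* Multiplicative ℤ, ∀ s, f s = 1) →
          (R.card : ℤ) - (Fintype.card X : ℤ) ≥ (AddGroup.rank (semigroupHomology 2 S) : ℤ))) := by
  refine ⟨fun X _ R M _ h => ?_, fun X _ R S _ h => ?_⟩
  · obtain ⟨a, ha⟩ := h.exists_isPresentedBy
    obtain ⟨hfg, h₁, h₂⟩ := ha.rank_monoidHomology_two_le
      {g : FreeGroup X | ∃ p ∈ R,
        g = FreeMonoid.lift FreeGroup.of p.1 * (FreeMonoid.lift FreeGroup.of p.2)⁻¹}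
      (fun g ⟨p, hp, hg⟩ => ⟨⟨p, hp⟩, hg⟩)
    rw [Nat.card_eq_fintype_card, Nat.card_eq_fintype_card, Fintype.card_coe] at h₁ h₂
    refine ⟨hfg, ?_, fun hM => ?_⟩
    · change _ ≤ _ + abelianizationRank (MonoidPresentationGroup R) at h₁
      omega
    · have := h₂ (hM.elim (fun _ f => f.eq_one_of_finite) id)
      omega
  · obtain ⟨a, ha⟩ := h.exists_isPresentedBy
    obtain ⟨hfg, h₁, h₂⟩ := ha.rank_monoidHomology_two_le
      {g : FreeGroup X | ∃ p ∈ R,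
        g = FreeSemigroup.lift FreeGroup.of p.1 * (FreeSemigroup.lift FreeGroup.of p.2)⁻¹}
      (fun g ⟨p, hp, hg⟩ => ⟨⟨p, hp⟩, by simpa only [FreeSemigroup.lift_toFreeMonoid] using hg⟩)
    rw [Nat.card_eq_fintype_card, Nat.card_eq_fintype_card, Fintype.card_coe] at h₁ h₂
    refine ⟨hfg, ?_, fun hS => ?_⟩
    · change _ ≤ _ + abelianizationRank (SemigroupPresentationGroup R) at h₁
      change (R.card : ℤ) - (Fintype.card X : ℤ) ≥ (AddGroup.rank (monoidHomology 2 (WithOne S)) : ℤ)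
        - (abelianizationRank (SemigroupPresentationGroup R) : ℤ)
      omega
    · have hfin (_ : Finite S) : Finite (WithOne S) := inferInstanceAs (Finite (Option S))
      have := h₂ (hS.elim (fun h f => have := hfin h; f.eq_one_of_finite) WithOne.monoidHom_eq_one)
      change (R.card : ℤ) - (Fintype.card X : ℤ) ≥ (AddGroup.rank (monoidHomology 2 (WithOne S)) : ℤ)
      omega
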